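/- Let $(H,\Delta)$ be a CQG Hopf $*$-algebra, i.e. a complex Hopf algebra (with counit $\varepsilon$ and antipode $S$) equipped with an antilinear antimultiplicative involution $*$ satisfying $\Delta(a^*)=\Delta(a)^{*\otimes *}$, and admitting a (necessarily unique) invariant state: a linear functional $\Phi_H:H\to\mathbb{C}$ with $\Phi_H(1)=1$, $\Phi_H(a^*a)\ge 0$ and $(\Phi_H\otimes \mathrm{id})\Delta(a)=\Phi_H(a)1=(\mathrm{id}\otimes\Phi_H)\Delta(a)$ for all $a\in H$. The antipode of $H$ is then bijective, with $S^{-1}(a)=S(a^*)^*$. Let ${}_H\mathrm{YD}^H$ be the category of Yetter–Drinfeld modules: complex vector spaces $V$ with a left $H$-module structure and a right $H$-comodule structure $\delta(v)=v_{(0)}\otimes v_{(1)}$ such that $$\delta(hv)=h_{(2)}v_{(0)}\otimes h_{(3)}v_{(1)}S^{-1}(h_{(1)}),\qquad h\in H,\ v\in V,$$ with the $H$-linear and $H$-colinear maps as morphisms. Consider the following two objects. * $H$ itself, with $h\rhd k=h_{(2)}kS^{-1}(h_{(1)})$ and $\delta=\Delta$. * The restricted dual $\mathcal{I}=\{\Phi_H(a\,-)\mid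 a\in H\}\subseteq \mathrm{Lin}_{\mathbb C}(H,\mathbb{C})$, with $h\blacktriangleright\omega=\omega(S^{-1}(h_{(2)})\,-\,h_{(1)})$ and with the right $H$-comodule structure $\omega\mapsto\omega_{(0)}\otimes\omega_{(1)}$ corresponding to left multiplication for the convolution product $\chi\omega=(\chi\otimes\omega)\circ\Delta$, i.e. the one determined by $\chi\omega=\chi(\omega_{(1)})\,\omega_{(0)}$ for all $\chi\in\mathcal{I}$. Then $H$ and $\mathcal{I}$ are isomorphic in ${}_H\mathrm{YD}^H$ if and only if $(H,\Delta)$ is of Kac type, i.e. $\Phi_H$ is tracial: $\Phi_H(ab)=\Phi_H(ba)$ for all $a,b\in H$. -/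

import Mathlib

open scoped TensorProduct ComplexOrder

noncomputable section

namespace CQG

open Coalgebra HopfAlgebra WithConv

universe u v w

set_option linter.unusedSectionVars false

/-- Left slice `(Φ ⊗ id)(p ⊗ q) = Φ(p) q`. -/
def sliceLeft {H : Type u} [AddCommGroup H] [Module ℂ H] (Φ : H →ₗ[ℂ] ℂ) : H ⊗[ℂ] H →ₗ[ℂ] H :=
  TensorProduct.lid ℂ H ∘ₗ Φ.rTensor H

/-- Right slice `(id ⊗ Φ)(p ⊗ q) = Φ(q) p`. -/
def sliceRight {H : Type u} [AddCommGroup H] [Module ℂ H] (Φ : H →ₗ[ℂ] ℂ) : H ⊗[ℂ] H →ₗ[ℂ] H :=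
  TensorProduct.rid ℂ H ∘ₗ Φ.lTensor H

/-- `Φ` is an invariant state: unital, positive, and left and right invariant. -/
structure IsInvariantState {H : Type u} [Ring H] [StarRing H] [HopfAlgebra ℂ H]
    (Φ : H →ₗ[ℂ] ℂ) : Prop where
  map_one : Φ 1 = 1
  nonneg : ∀ a : H, 0 ≤ Φ (star a * a)
  sliceLeft_comul : ∀ a : H, sliceLeft Φ (comul a) = Φ a • (1 : H)
  sliceRight_comul : ∀ a : H, sliceRight Φ (comul a) = Φ a • (1 : H)

/-- A CQG Hopf `*`-algebra: a complex Hopf algebra with an antilinear antimultiplicative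
involution for which `Δ` is a `*`-map, admitting an invariant state. -/
class CQGHopfStarAlgebra (H : Type u) [Ring H] [StarRing H] [HopfAlgebra ℂ H]
    [StarModule ℂ H] : Prop where
  comul_star : ∀ a : H, comul (R := ℂ) (star a) = star (comul (R := ℂ) a)
  exists_invariantState : ∃ Φ : H →ₗ[ℂ] ℂ, IsInvariantState Φ

section Basic

variable (H : Type u) [Ring H] [StarRing H] [HopfAlgebra ℂ H] [StarModule ℂ H]

/-- The inverse of the antipode of a Hopf `*`-algebra, `S⁻¹(a) = S(a*)*`. -/
def antipodeInv : H →ₗ[ℂ] H where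
  toFun a := star (antipode ℂ (star a))
  map_add' a b := by simp
  map_smul' c a := by simp

variable [CQGHopfStarAlgebra H]

/-- The Haar state, that is, the (unique) invariant state. -/
def haarState : H →ₗ[ℂ] ℂ := (CQGHopfStarAlgebra.exists_invariantState (H := H)).choose

theorem haarState_isInvariantState : IsInvariantState (haarState H) :=
  (CQGHopfStarAlgebra.exists_invariantState (H := H)).choose_spec

variable {H}

theorem IsInvariantState.eq_haarState {Φ : H →ₗ[ℂ] ℂ} (hΦ : IsInvariantState Φ) :
    Φ = haarState H := by
  ext a
  have h1 := congrArg (haarState H) (hΦ.sliceLeft_comul a)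
  have h2 := congrArg Φ ((haarState_isInvariantState H).sliceRight_comul a)
  have h3 : ∀ t : H ⊗[ℂ] H, haarState H (sliceLeft Φ t) = Φ (sliceRight (haarState H) t) := by
    intro t
    induction t with
    | zero => simp
    | tmul x y => simp [sliceLeft, sliceRight, mul_comm]
    | add x y hx hy => simp [hx, hy]
  rw [h3, h2] at h1
  simpa [(haarState_isInvariantState H).map_one, hΦ.map_one] using h1.symm

/-- A comultiplication representation of `a*` obtained from one of `a`. -/
def starRepr {ι : Type*} {a : H} (𝓡 : Coalgebra.Repr ℂ a ι) : Coalgebra.Repr ℂ (star a) ι where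
  index := 𝓡.index
  left i := star (𝓡.left i)
  right i := star (𝓡.right i)
  eq := by
    rw [CQGHopfStarAlgebra.comul_star, ← 𝓡.eq, star_sum]
    simp

theorem counit_star (a : H) : counit (R := ℂ) (star a) = star (counit (R := ℂ) a) := by
  have h1 : ∑ i ∈ (ℛ ℂ a).index, star (counit (R := ℂ) (star ((ℛ ℂ a).left i))) • (ℛ ℂ a).right i
      = a := by
    have h := congrArg star (sum_counit_smul (starRepr (ℛ ℂ a)))
    simpa [starRepr, star_sum] using h
  have h2 : ∑ i ∈ (ℛ ℂ a).index, counit (R := ℂ) ((ℛ ℂ a).right i) • (ℛ ℂ a).left i = a := by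
    have h := congrArg (TensorProduct.rid ℂ H) (sum_tmul_counit_eq (R := ℂ) (ℛ ℂ a))
    simpa only [map_sum, TensorProduct.rid_tmul, one_smul] using h
  have h3 := congrArg (counit (R := ℂ)) h1
  have h4 := congrArg (fun x => counit (R := ℂ) (star x)) h2
  simp only [map_sum, star_sum, star_smul, map_smul, smul_eq_mul] at h3 h4
  rw [← h4, ← h3, star_sum]
  refine Finset.sum_congr rfl fun i _ => ?_
  simp [mul_comm]

theorem antipodeInv_apply (a : H) : antipodeInv H a = star (antipode ℂ (star a)) := rfl

/-- The linear map `a ↦ op a`. -/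
abbrev opL (A : Type u) [Ring A] [Algebra ℂ A] : A →ₗ[ℂ] Aᵐᵒᵖ :=
  (MulOpposite.opLinearEquiv ℂ).toLinearMap

theorem sum_antipodeInv_mul {ι : Type*} {a : H} (𝓡 : Coalgebra.Repr ℂ a ι) :
    ∑ i ∈ 𝓡.index, antipodeInv H (𝓡.right i) * 𝓡.left i = counit (R := ℂ) a • (1 : H) := by
  have h := congrArg star (sum_mul_antipode_eq_smul (starRepr 𝓡))
  simpa [starRepr, star_sum, counit_star, antipodeInv_apply] using h

theorem sum_mul_antipodeInv {ι : Type*} {a : H} (𝓡 : Coalgebra.Repr ℂ a ι) :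
    ∑ i ∈ 𝓡.index, 𝓡.right i * antipodeInv H (𝓡.left i) = counit (R := ℂ) a • (1 : H) := by
  have h := congrArg star (sum_antipode_mul_eq_smul (starRepr 𝓡))
  simpa [starRepr, star_sum, counit_star, antipodeInv_apply] using h

theorem antipode_antipodeInv (a : H) : antipode ℂ (antipodeInv H a) = a := by
  have h1 : toConv (antipode ℂ (A := H)) * toConv (antipode ℂ (A := H) ∘ₗ antipodeInv H) = 1 := by
    ext a
    rw [(ℛ ℂ a).convMul_apply]
    have h := congrArg (antipode ℂ) (sum_antipodeInv_mul (ℛ ℂ a))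
    simpa [antipode_mul_antidistrib, Algebra.algebraMap_eq_smul_one] using h
  have h2 : toConv (LinearMap.id) = toConv (antipode ℂ (A := H) ∘ₗ antipodeInv H) :=
    left_inv_eq_right_inv LinearMap.id_mul_antipode h1
  exact (LinearMap.congr_fun (toConv_injective h2) a).symm

theorem antipodeInv_antipode (a : H) : antipodeInv H (antipode ℂ a) = a := by
  have h := antipode_antipodeInv (star a)
  rw [antipodeInv_apply, star_star] at h
  rw [antipodeInv_apply, h, star_star]

theorem antipodeInv_mul (a b : H) : antipodeInv H (a * b) = antipodeInv H b * antipodeInv H a := by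
  simp [antipodeInv_apply, antipode_mul_antidistrib]

theorem antipodeInv_one : antipodeInv H 1 = 1 := by
  simp [antipodeInv_apply]

/-! Convolution identities, in the algebra of linear maps from `H` to an algebra. -/

/-- The algebra map `a ↦ a ⊗ 1`. -/
abbrev inlT : H →ₐ[ℂ] H ⊗[ℂ] H := Algebra.TensorProduct.includeLeft
/-- The algebra map `b ↦ 1 ⊗ b`. -/
abbrev inrT : H →ₐ[ℂ] H ⊗[ℂ] H := Algebra.TensorProduct.includeRight

theorem conv_inl_inr :
    toConv (inlT (H := H)).toLinearMap * toConv (inrT (H := H)).toLinearMap =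
      toConv (comul (R := ℂ) (A := H)) := by
  ext a
  rw [(ℛ ℂ a).convMul_apply]
  simp [(ℛ ℂ a).eq]

theorem conv_op_inl_inr :
    toConv (opL _ ∘ₗ (inlT (H := H)).toLinearMap) * toConv (opL _ ∘ₗ (inrT (H := H)).toLinearMap) =
      toConv (opL _ ∘ₗ comul (R := ℂ) (A := H)) := by
  ext a
  rw [(ℛ ℂ a).convMul_apply]
  apply MulOpposite.unop_injective
  simp [← MulOpposite.op_mul, (ℛ ℂ a).eq]

theorem conv_op_antipodeInv_left {A : Type u} [Ring A] [Algebra ℂ A] (f : H →ₐ[ℂ] A) :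
    toConv (opL _ ∘ₗ f.toLinearMap ∘ₗ antipodeInv H) * toConv (opL _ ∘ₗ f.toLinearMap) = 1 := by
  ext a
  rw [(ℛ ℂ a).convMul_apply]
  have h := congrArg f (sum_mul_antipodeInv (ℛ ℂ a))
  apply MulOpposite.unop_injective
  simpa [← MulOpposite.op_mul, Algebra.algebraMap_eq_smul_one] using h

theorem conv_op_antipodeInv_right {A : Type u} [Ring A] [Algebra ℂ A] (f : H →ₐ[ℂ] A) :
    toConv (opL _ ∘ₗ f.toLinearMap) * toConv (opL _ ∘ₗ f.toLinearMap ∘ₗ antipodeInv H) = 1 := by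
  ext a
  rw [(ℛ ℂ a).convMul_apply]
  have h := congrArg f (sum_antipodeInv_mul (ℛ ℂ a))
  apply MulOpposite.unop_injective
  simpa [← MulOpposite.op_mul, Algebra.algebraMap_eq_smul_one] using h

theorem conv_op_comul_antipodeInv :
    toConv (opL _ ∘ₗ (inrT (H := H)).toLinearMap ∘ₗ antipodeInv H) *
      toConv (opL _ ∘ₗ (inlT (H := H)).toLinearMap ∘ₗ antipodeInv H) =
      toConv (opL _ ∘ₗ comul (R := ℂ) (A := H) ∘ₗ antipodeInv H) := by
  refine (left_inv_eq_right_inv (a := toConv (opL _ ∘ₗ comul (R := ℂ) (A := H))) 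
    (conv_op_antipodeInv_left (Bialgebra.comulAlgHom ℂ H)) ?_).symm
  rw [← conv_op_inl_inr, mul_assoc, ← mul_assoc (toConv (opL _ ∘ₗ (inrT (H := H)).toLinearMap)),
    conv_op_antipodeInv_right, one_mul, conv_op_antipodeInv_right]

theorem conv_comul_antipodeInv_repr {ι : Type*} {a : H} (𝓡 : Coalgebra.Repr ℂ a ι) :
    comul (R := ℂ) (antipodeInv H a) =
      ∑ i ∈ 𝓡.index, antipodeInv H (𝓡.right i) ⊗ₜ[ℂ] antipodeInv H (𝓡.left i) := by
  have h := congrArg (fun f => MulOpposite.unop (f a)) (conv_op_comul_antipodeInv (H := H))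
  simp only [𝓡.convMul_apply] at h
  simpa [← MulOpposite.op_mul] using h.symm

theorem tmul_one_eq {ι : Type*} {a : H} (𝓡 : Coalgebra.Repr ℂ a ι) :
    (a ⊗ₜ[ℂ] (1 : H)) = ∑ i ∈ 𝓡.index,
      ((1 : H) ⊗ₜ[ℂ] antipodeInv H (𝓡.right i)) * comul (R := ℂ) (𝓡.left i) := by
  have h : toConv (opL _ ∘ₗ (inlT (H := H)).toLinearMap) = 
    toConv (opL _ ∘ₗ comul (R := ℂ) (A := H)) *
      toConv (opL _ ∘ₗ (inrT (H := H)).toLinearMap ∘ₗ antipodeInv H) := by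
    rw [← conv_op_inl_inr, mul_assoc, conv_op_antipodeInv_right, mul_one]
  replace h := congrArg (fun f => MulOpposite.unop (f a)) h
  simp only [𝓡.convMul_apply] at h
  simpa [← MulOpposite.op_mul] using h

theorem one_tmul_eq_left {ι : Type*} {a : H} (𝓡 : Coalgebra.Repr ℂ a ι) :
    ((1 : H) ⊗ₜ[ℂ] a) = ∑ i ∈ 𝓡.index,
      (antipode ℂ (𝓡.left i) ⊗ₜ[ℂ] (1 : H)) * comul (R := ℂ) (𝓡.right i) := by
  have h0 : toConv ((inlT (H := H)).toLinearMap ∘ₗ antipode ℂ (A := H)) *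
      toConv (inlT (H := H)).toLinearMap = 1 := by
    ext a
    rw [(ℛ ℂ a).convMul_apply]
    have h := congrArg (inlT (H := H)) (sum_antipode_mul_eq_smul (R := ℂ) (ℛ ℂ a))
    simpa [Algebra.algebraMap_eq_smul_one, Algebra.TensorProduct.one_def] using h
  have h : toConv (inrT (H := H)).toLinearMap =
      toConv ((inlT (H := H)).toLinearMap ∘ₗ antipode ℂ (A := H)) *
        toConv (comul (R := ℂ) (A := H)) := by
    rw [← conv_inl_inr, ← mul_assoc, h0, one_mul]
  replace h := congrArg (fun f => f a) h
  simp only [𝓡.convMul_apply] at h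
  simpa using h

theorem one_tmul_eq_right {ι : Type*} {a : H} (𝓡 : Coalgebra.Repr ℂ a ι) :
    ((1 : H) ⊗ₜ[ℂ] a) = ∑ i ∈ 𝓡.index,
      comul (R := ℂ) (𝓡.right i) * (antipodeInv H (𝓡.left i) ⊗ₜ[ℂ] (1 : H)) := by
  have h : toConv (opL _ ∘ₗ (inrT (H := H)).toLinearMap) =
    toConv (opL _ ∘ₗ (inlT (H := H)).toLinearMap ∘ₗ antipodeInv H) *
      toConv (opL _ ∘ₗ comul (R := ℂ) (A := H)) := by
    rw [← conv_op_inl_inr, ← mul_assoc, conv_op_antipodeInv_left, one_mul]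
  replace h := congrArg (fun f => MulOpposite.unop (f a)) h
  simp only [𝓡.convMul_apply] at h
  simpa [← MulOpposite.op_mul] using h

theorem sliceLeft_mul (Φ : H →ₗ[ℂ] ℂ) (b : H) (t : H ⊗[ℂ] H) :
    sliceLeft Φ (((1 : H) ⊗ₜ[ℂ] b) * t) = b * sliceLeft Φ t := by
  induction t with
  | zero => simp
  | tmul x y => simp [sliceLeft]
  | add x y hx hy => simp only [mul_add, map_add, hx, hy]

theorem sliceRight_mul (Φ : H →ₗ[ℂ] ℂ) (b : H) (t : H ⊗[ℂ] H) :
    sliceRight Φ ((b ⊗ₜ[ℂ] (1 : H)) * t) = b * sliceRight Φ t := by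
  induction t with
  | zero => simp
  | tmul x y => simp [sliceRight]
  | add x y hx hy => simp only [mul_add, map_add, hx, hy]

theorem sliceRight_mul' (Φ : H →ₗ[ℂ] ℂ) (b : H) (t : H ⊗[ℂ] H) :
    sliceRight Φ (t * (b ⊗ₜ[ℂ] (1 : H))) = sliceRight Φ t * b := by
  induction t with
  | zero => simp
  | tmul x y => simp [sliceRight]
  | add x y hx hy => simp only [add_mul, map_add, hx, hy]

/-- `x₁ Φ(a x₂) = S(a₁) Φ(a₂ x)`. -/
theorem strong_invariance_right {ι : Type*} {a : H} (𝓡 : Coalgebra.Repr ℂ a ι) (x : H) :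
    sliceRight (haarState H) (((1 : H) ⊗ₜ[ℂ] a) * comul (R := ℂ) x) =
      ∑ i ∈ 𝓡.index, haarState H (𝓡.right i * x) • antipode ℂ (𝓡.left i) := by
  rw [one_tmul_eq_left 𝓡, Finset.sum_mul, map_sum]
  refine Finset.sum_congr rfl fun i _ => ?_
  rw [mul_assoc, ← Bialgebra.comul_mul, sliceRight_mul,
    (haarState_isInvariantState H).sliceRight_comul]
  simp

/-- `Φ(a x₁) x₂ = S⁻¹(a₂) Φ(a₁ x)`. -/
theorem strong_invariance_left {ι : Type*} {a : H} (𝓡 : Coalgebra.Repr ℂ a ι) (x : H) :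
    sliceLeft (haarState H) ((a ⊗ₜ[ℂ] (1 : H)) * comul (R := ℂ) x) =
      ∑ i ∈ 𝓡.index, haarState H (𝓡.left i * x) • antipodeInv H (𝓡.right i) := by
  rw [tmul_one_eq 𝓡, Finset.sum_mul, map_sum]
  refine Finset.sum_congr rfl fun i _ => ?_
  rw [mul_assoc, ← Bialgebra.comul_mul, sliceLeft_mul,
    (haarState_isInvariantState H).sliceLeft_comul]
  simp

/-- `x₁ Φ(x₂ a) = S⁻¹(a₁) Φ(x a₂)`. -/
theorem strong_invariance_right' {ι : Type*} {a : H} (𝓡 : Coalgebra.Repr ℂ a ι) (x : H) :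
    sliceRight (haarState H) (comul (R := ℂ) x * ((1 : H) ⊗ₜ[ℂ] a)) =
      ∑ i ∈ 𝓡.index, haarState H (x * 𝓡.right i) • antipodeInv H (𝓡.left i) := by
  rw [one_tmul_eq_right 𝓡, Finset.mul_sum, map_sum]
  refine Finset.sum_congr rfl fun i _ => ?_
  rw [← mul_assoc, ← Bialgebra.comul_mul, sliceRight_mul',
    (haarState_isInvariantState H).sliceRight_comul]
  simp


/-- The Haar state is nondegenerate. -/
theorem haarState_faithful {a : H} (ha : ∀ x : H, haarState H (x * a) = 0) : a = 0 := by
  have key : ∀ a : H, (∀ x : H, haarState H (x * a) = 0) →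
      ∃ 𝓡 : Coalgebra.Repr ℂ a (Module.Basis.ofVectorSpaceIndex ℂ H),
        ∀ i ∈ 𝓡.index, ∀ x : H, haarState H (x * 𝓡.right i) = 0 := by
    intro a ha
    let 𝓑 := Module.Basis.ofVectorSpace ℂ H
    obtain ⟨c, hc⟩ := TensorProduct.eq_repr_basis_left 𝓑 (comul (R := ℂ) a)
    let 𝓡 : Coalgebra.Repr ℂ a (Module.Basis.ofVectorSpaceIndex ℂ H) :=
      { index := c.support, left := fun i => 𝓑 i, right := fun i => c i, eq := hc }
    refine ⟨𝓡, fun i hi x => ?_⟩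
    have h0 : ∀ t : H ⊗[ℂ] H, sliceRight (haarState H) (t * ((1 : H) ⊗ₜ[ℂ] a)) = 0 := by
      intro t
      induction t with
      | zero => simp
      | tmul p q => simp [sliceRight, ha]
      | add p q hp hq => rw [add_mul, map_add, hp, hq, add_zero]
    have h1 := strong_invariance_right' 𝓡 x
    rw [h0] at h1
    have h2 := congrArg (antipode ℂ) h1
    simp only [map_zero, map_sum, map_smul, antipode_antipodeInv] at h2
    exact linearIndependent_iff'.1 𝓑.linearIndependent _ _ h2.symm i hi
  have key2 : ∀ a : H, (∀ x : H, haarState H (x * a) = 0) → counit (R := ℂ) a = 0 := by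
    intro a ha
    obtain ⟨𝓡, h𝓡⟩ := key a ha
    have h := congrArg (haarState H) (sum_antipode_mul_eq_smul (R := ℂ) 𝓡)
    rw [map_sum, Finset.sum_eq_zero (fun i hi => h𝓡 i hi _)] at h
    simpa [(haarState_isInvariantState H).map_one] using h.symm
  obtain ⟨𝓡, h𝓡⟩ := key a ha
  have h := congrArg (TensorProduct.rid ℂ H) (sum_tmul_counit_eq (R := ℂ) 𝓡)
  simp only [map_sum, TensorProduct.rid_tmul, one_smul] at h
  rw [← h]
  exact Finset.sum_eq_zero fun i hi => by rw [key2 _ (h𝓡 i hi), zero_smul]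

theorem exists_local_counit (s : Finset H) :
    ∃ e : H, ∀ y ∈ s, haarState H (e * y) = counit (R := ℂ) y := by
  let W : Submodule ℂ H := Submodule.span ℂ (s : Set H)
  have : FiniteDimensional ℂ W := FiniteDimensional.span_finset ℂ s
  let T : H →ₗ[ℂ] Module.Dual ℂ W :=
    (LinearMap.lcomp ℂ ℂ W.subtype) ∘ₗ ((LinearMap.mul ℂ H).compr₂ (haarState H))
  have hT : LinearMap.range T = ⊤ := by
    rw [← Subspace.dualCoannihilator_dualAnnihilator_eq (W := LinearMap.range T)]
    have : (LinearMap.range T).dualCoannihilator = ⊥ := by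
      rw [eq_bot_iff]
      intro w hw
      rw [Submodule.mem_dualCoannihilator] at hw
      have : (w : H) = 0 := haarState_faithful fun x => hw (T x) ⟨x, rfl⟩
      simpa using this
    rw [this, Submodule.dualAnnihilator_bot]
  obtain ⟨e, he⟩ : counit (R := ℂ) (A := H) ∘ₗ W.subtype ∈ LinearMap.range T := hT ▸ trivial
  exact ⟨e, fun y hy => LinearMap.congr_fun he ⟨y, Submodule.subset_span hy⟩⟩

variable (H) in
/-- The map `a ↦ Φ(a -)` from `H` to its full linear dual. -/
def haarFunctional : H →ₗ[ℂ] Module.Dual ℂ H := (LinearMap.mul ℂ H).compr₂ (haarState H)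

@[simp]
theorem haarFunctional_apply (a x : H) : haarFunctional H a x = haarState H (a * x) := rfl

variable (H) in
/-- The restricted dual `{Φ(a -) | a ∈ H}` of `H`, inside the full linear dual. -/
def restrictedDual : Submodule ℂ (Module.Dual ℂ H) := LinearMap.range (haarFunctional H)

/-- The functionals `Φ(- b)` lie in the restricted dual as well. -/
theorem haarFunctional_right_mem (b : H) :
    haarState H ∘ₗ LinearMap.mulRight ℂ b ∈ restrictedDual H := by
  classical
  let 𝓡 := ℛ ℂ b
  obtain ⟨e, he⟩ := exists_local_counit (𝓡.index.image fun i => antipodeInv H (𝓡.left i))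
  let χ : H →ₗ[ℂ] ℂ := haarState H ∘ₗ LinearMap.mulRight ℂ b
  let 𝓔 := ℛ ℂ e
  refine ⟨∑ i ∈ 𝓔.index, χ (antipodeInv H (𝓔.right i)) • 𝓔.left i, ?_⟩
  ext x
  have h1 := congrArg (haarState H)
    (congrArg (e * ·) (strong_invariance_right' 𝓡 x))
  have h2 := congrArg χ (strong_invariance_left 𝓔 x)
  have h3 : ∀ t : H ⊗[ℂ] H,
      haarState H (e * sliceRight (haarState H) (t * ((1 : H) ⊗ₜ[ℂ] b))) =
        χ (sliceLeft (haarState H) ((e ⊗ₜ[ℂ] (1 : H)) * t)) := by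
    intro t
    induction t with
    | zero => simp
    | tmul p q => simp [sliceLeft, sliceRight, χ, mul_comm]
    | add p q hp hq => simp only [add_mul, mul_add, map_add, hp, hq]
  rw [h3, h2] at h1
  have h4 : ∑ i ∈ 𝓡.index, counit (R := ℂ) (𝓡.left i) • 𝓡.right i = b := sum_counit_smul 𝓡
  calc haarFunctional H (∑ i ∈ 𝓔.index, χ (antipodeInv H (𝓔.right i)) • 𝓔.left i) x
      = χ (∑ i ∈ 𝓔.index, haarState H (𝓔.left i * x) • antipodeInv H (𝓔.right i)) := by
        simp [mul_comm]
    _ = haarState H (x * ∑ i ∈ 𝓡.index, counit (R := ℂ) (𝓡.left i) • 𝓡.right i) := by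
        rw [h1, Finset.mul_sum, map_sum, Finset.mul_sum, map_sum]
        refine Finset.sum_congr rfl fun i hi => ?_
        rw [mul_smul_comm, map_smul, he _ (Finset.mem_image_of_mem _ hi), mul_smul_comm, map_smul]
        simp [antipodeInv_apply, counit_star, mul_comm]
    _ = χ x := by rw [h4]; rfl

end Basic

section YetterDrinfeld

variable (H : Type u) [Ring H] [StarRing H] [HopfAlgebra ℂ H] [StarModule ℂ H]

variable {H} in
/-- For a linear map `act : H → End V`, the linear map
`h ↦ (v ⊗ k ↦ h₂ v ⊗ h₃ k S⁻¹(h₁))` from `H` to `End (V ⊗ H)`, as the convolution product of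
`a ↦ (v ⊗ k ↦ v ⊗ k S⁻¹(a))`, `b ↦ (v ⊗ k ↦ b v ⊗ k)` and `c ↦ (v ⊗ k ↦ v ⊗ c k)`. -/
def ydTwist {V : Type v} [AddCommGroup V] [Module ℂ V] (act : H →ₗ[ℂ] Module.End ℂ V) :
    H →ₗ[ℂ] Module.End ℂ (V ⊗[ℂ] H) :=
  (toConv (LinearMap.lTensorHom V ∘ₗ (LinearMap.mul ℂ H).flip ∘ₗ antipodeInv H) *
    toConv (LinearMap.rTensorHom H ∘ₗ act) *
    toConv (LinearMap.lTensorHom V ∘ₗ LinearMap.mul ℂ H)).ofConv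

variable {H} in
/-- The formula for `ydTwist` in Sweedler notation. -/
theorem ydTwist_apply_tmul {V : Type v} [AddCommGroup V] [Module ℂ V]
    (act : H →ₗ[ℂ] Module.End ℂ V) {ι : Type*} {κ : ι → Type*} {h : H}
    (𝓡 : Coalgebra.Repr ℂ h ι) (𝓢 : ∀ i, Coalgebra.Repr ℂ (𝓡.right i) (κ i)) (v : V) (k : H) :
    ydTwist act h (v ⊗ₜ[ℂ] k) = ∑ i ∈ 𝓡.index, ∑ j ∈ (𝓢 i).index,
      act ((𝓢 i).left j) v ⊗ₜ[ℂ] ((𝓢 i).right j * k * antipodeInv H (𝓡.left i)) := by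
  unfold ydTwist
  rw [mul_assoc, 𝓡.convMul_apply, LinearMap.sum_apply]
  refine Finset.sum_congr rfl fun i _ => ?_
  rw [(𝓢 i).convMul_apply, Finset.mul_sum, LinearMap.sum_apply]
  simp

/-- Yetter-Drinfeld modules over `H`: left `H`-modules with a right `H`-comodule structure `δ`
such that `δ(h v) = h₂ v₀ ⊗ h₃ v₁ S⁻¹(h₁)`. -/
structure YDModule where
  carrier : Type v
  [addCommGroup : AddCommGroup carrier]
  [module : Module ℂ carrier]
  /-- the left `H`-module structure -/
  act : H →ₐ[ℂ] Module.End ℂ carrier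
  /-- the right `H`-comodule structure -/
  coact : carrier →ₗ[ℂ] carrier ⊗[ℂ] H
  coassoc : ∀ v, TensorProduct.assoc ℂ carrier H H (coact.rTensor H (coact v)) =
    (comul (R := ℂ) (A := H)).lTensor carrier (coact v)
  rTensor_counit : ∀ v, TensorProduct.rid ℂ carrier
    ((counit (R := ℂ) (A := H)).lTensor carrier (coact v)) = v
  compat : ∀ h v, coact (act h v) = ydTwist act.toLinearMap h (coact v)

attribute [instance] YDModule.addCommGroup YDModule.module

namespace YDModule

variable {H}

/-- Morphisms of Yetter-Drinfeld modules: linear maps that are `H`-linear and `H`-colinear. -/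
@[ext]
structure Hom (M N : YDModule.{u, v} H) where
  toLinearMap : M.carrier →ₗ[ℂ] N.carrier
  map_act : ∀ h v, toLinearMap (M.act h v) = N.act h (toLinearMap v)
  map_coact : ∀ v, N.coact (toLinearMap v) = toLinearMap.rTensor H (M.coact v)

/-- The category of Yetter-Drinfeld modules. -/
instance : CategoryTheory.Category (YDModule.{u, v} H) where
  Hom := Hom
  id M := ⟨LinearMap.id, fun _ _ => rfl, fun _ => by simp⟩
  comp f g := ⟨g.toLinearMap ∘ₗ f.toLinearMap, fun h v => by simp [f.map_act, g.map_act],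
    fun v => by simp [f.map_coact, g.map_coact, LinearMap.rTensor_comp_apply]⟩

end YDModule

variable [CQGHopfStarAlgebra H]

variable {H} in
theorem sum_algLift_apply {V : Type v} [AddCommGroup V] [Module ℂ V]
    (f g : H →ₐ[ℂ] Module.End ℂ V) (hfg : ∀ a b, Commute (f a) (g b)) {ι : Type*} {h : H}
    (𝓡 : Coalgebra.Repr ℂ h ι) (v : V) :
    (Algebra.TensorProduct.lift f g hfg).comp (Bialgebra.comulAlgHom ℂ H) h v =
      ∑ i ∈ 𝓡.index, f (𝓡.left i) (g (𝓡.right i) v) := by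
  rw [AlgHom.comp_apply, Bialgebra.comulAlgHom_apply, ← 𝓡.eq, map_sum, LinearMap.sum_apply]
  refine Finset.sum_congr rfl fun i _ => ?_
  rw [Algebra.TensorProduct.lift_tmul]
  rfl

/-- The action `(a, k) ↦ k S⁻¹(a)` of `H` on itself. -/
def rightMulInvAct : H →ₐ[ℂ] Module.End ℂ H :=
  AlgHom.ofLinearMap ((LinearMap.mul ℂ H).flip ∘ₗ antipodeInv H)
    (by ext; simp [antipodeInv_one]) (fun a b => by ext; simp [antipodeInv_mul, mul_assoc])

theorem commute_rightMulInvAct (a b : H) : Commute (rightMulInvAct H a) (Algebra.lmul ℂ H b) := by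
  ext
  simp [rightMulInvAct, mul_assoc]

/-- The adjoint-type action `h ▷ k = h₂ k S⁻¹(h₁)` of `H` on itself. -/
def adjointAct : H →ₐ[ℂ] Module.End ℂ H :=
  (Algebra.TensorProduct.lift (rightMulInvAct H) (Algebra.lmul ℂ H)
    (commute_rightMulInvAct H)).comp (Bialgebra.comulAlgHom ℂ H)

variable {H} in
theorem adjointAct_apply {ι : Type*} {h : H} (𝓡 : Coalgebra.Repr ℂ h ι) (k : H) :
    adjointAct H h k = ∑ i ∈ 𝓡.index, 𝓡.right i * k * antipodeInv H (𝓡.left i) := by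
  rw [adjointAct, sum_algLift_apply _ _ _ 𝓡]
  rfl

/-- The action `(a, ω) ↦ ω(- a)` of `H` on its full linear dual. -/
def dualActRight : H →ₐ[ℂ] Module.End ℂ (Module.Dual ℂ H) :=
  AlgHom.ofLinearMap
    (LinearMap.mk₂ ℂ (fun (a : H) (ω : Module.Dual ℂ H) => ω ∘ₗ LinearMap.mulRight ℂ a)
      (by intros; ext; simp [mul_add]) (by intros; ext; simp)
      (by intros; ext; simp) (by intros; ext; simp))
    (by ext; simp) (fun a b => by ext; simp [mul_assoc])

/-- The action `(b, ω) ↦ ω(S⁻¹(b) -)` of `H` on its full linear dual. -/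
def dualActLeft : H →ₐ[ℂ] Module.End ℂ (Module.Dual ℂ H) :=
  AlgHom.ofLinearMap
    (LinearMap.mk₂ ℂ
      (fun (b : H) (ω : Module.Dual ℂ H) => ω ∘ₗ LinearMap.mulLeft ℂ (antipodeInv H b))
      (by intros; ext; simp [add_mul]) (by intros; ext; simp)
      (by intros; ext; simp) (by intros; ext; simp))
    (by ext; simp [antipodeInv_one]) (fun a b => by ext; simp [antipodeInv_mul])

theorem commute_dualAct (a b : H) : Commute (dualActRight H a) (dualActLeft H b) := by
  ext
  simp [dualActRight, dualActLeft, mul_assoc]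

/-- The action `h ▶ ω = ω(S⁻¹(h₂) - h₁)` of `H` on its full linear dual. -/
def dualAct : H →ₐ[ℂ] Module.End ℂ (Module.Dual ℂ H) :=
  (Algebra.TensorProduct.lift (dualActRight H) (dualActLeft H) (commute_dualAct H)).comp
      (Bialgebra.comulAlgHom ℂ H)

variable {H} in
theorem dualAct_apply {ι : Type*} {h : H} (𝓡 : Coalgebra.Repr ℂ h ι) (ω : Module.Dual ℂ H)
    (x : H) : dualAct H h ω x =
      ∑ i ∈ 𝓡.index, ω (antipodeInv H (𝓡.right i) * x * 𝓡.left i) := by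
  rw [dualAct, sum_algLift_apply _ _ _ 𝓡, LinearMap.sum_apply]
  refine Finset.sum_congr rfl fun i _ => ?_
  simp [dualActRight, dualActLeft, mul_assoc]

variable {H} in
theorem dualAct_mem (h : H) (ω : Module.Dual ℂ H) (hω : ω ∈ restrictedDual H) :
    dualAct H h ω ∈ restrictedDual H := by
  obtain ⟨a, rfl⟩ := hω
  have : dualAct H h (haarFunctional H a) = ∑ i ∈ (ℛ ℂ h).index,
      (haarState H ∘ₗ LinearMap.mulRight ℂ ((ℛ ℂ h).left i)) ∘ₗ
        LinearMap.mulLeft ℂ (a * antipodeInv H ((ℛ ℂ h).right i)) := by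
    ext x
    simp [dualAct_apply (ℛ ℂ h), mul_assoc]
  rw [this]
  refine Submodule.sum_mem _ fun i _ => ?_
  obtain ⟨b, hb⟩ := haarFunctional_right_mem ((ℛ ℂ h).left i)
  rw [← hb]
  exact ⟨b * (a * antipodeInv H ((ℛ ℂ h).right i)), by ext x; simp [mul_assoc]⟩

/-- The action `h ▶ ω = ω(S⁻¹(h₂) - h₁)` of `H` on the restricted dual. -/
def restrictedDualAct : H →ₐ[ℂ] Module.End ℂ (restrictedDual H) :=
  AlgHom.ofLinearMap
    { toFun := fun h => (dualAct H h).restrict (dualAct_mem h)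
      map_add' := fun a b => by ext; simp
      map_smul' := fun c a => by ext; simp }
    (by ext; simp) (fun a b => by ext; simp)

theorem coe_restrictedDualAct (h : H) (ω : restrictedDual H) :
    (restrictedDualAct H h ω : Module.Dual ℂ H) = dualAct H h ω := rfl

/-- The canonical map sending `ω ⊗ m` to the linear map `x ↦ ω(x) m`. -/
def evalTensor (M : Type v) [AddCommGroup M] [Module ℂ M] :
    restrictedDual H ⊗[ℂ] M →ₗ[ℂ] H →ₗ[ℂ] M :=
  dualTensorHom ℂ H M ∘ₗ (restrictedDual H).subtype.rTensor M

@[simp]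
theorem evalTensor_tmul (M : Type v) [AddCommGroup M] [Module ℂ M] (ω : restrictedDual H)
    (m : M) (x : H) : evalTensor H M (ω ⊗ₜ m) x = (ω : Module.Dual ℂ H) x • m := by
  simp [evalTensor]

theorem evalTensor_injective (M : Type v) [AddCommGroup M] [Module ℂ M] :
    Function.Injective (evalTensor H M) := by
  rw [injective_iff_map_eq_zero]
  intro t ht
  let 𝓑 := Module.Basis.ofVectorSpace ℂ M
  obtain ⟨c, rfl⟩ := TensorProduct.eq_repr_basis_right 𝓑 t
  refine Finset.sum_eq_zero fun i hi => ?_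
  have hc : c i = 0 := by
    ext x
    have h := LinearMap.congr_fun ht x
    simp only [Finsupp.sum, map_sum, LinearMap.sum_apply, evalTensor_tmul] at h
    exact linearIndependent_iff'.1 𝓑.linearIndependent _ _ h i hi
  simp [hc]

/-- For a functional `ω`, the linear map `x ↦ x₁ ω(x₂)`. -/
def rightTranslate : Module.Dual ℂ H →ₗ[ℂ] H →ₗ[ℂ] H where
  toFun ω := sliceRight ω ∘ₗ comul (R := ℂ)
  map_add' a b := by ext; simp [sliceRight, LinearMap.lTensor_add]
  map_smul' c a := by ext; simp [sliceRight, LinearMap.lTensor_smul]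

variable {H} in
theorem rightTranslate_apply {ι : Type*} {x : H} (𝓡 : Coalgebra.Repr ℂ x ι)
    (ω : Module.Dual ℂ H) :
    rightTranslate H ω x = ∑ i ∈ 𝓡.index, ω (𝓡.right i) • 𝓡.left i := by
  simp [rightTranslate, sliceRight, ← 𝓡.eq]

theorem rightTranslate_mem (ω : restrictedDual H) :
    rightTranslate H ω ∈ LinearMap.range (evalTensor H H) := by
  obtain ⟨_, a, rfl⟩ := ω
  refine ⟨∑ i ∈ (ℛ ℂ a).index,
    (⟨haarFunctional H ((ℛ ℂ a).right i), ⟨_, rfl⟩⟩ : restrictedDual H) ⊗ₜ[ℂ]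
      antipode ℂ ((ℛ ℂ a).left i), ?_⟩
  ext x
  have h1 : ∀ t : H ⊗[ℂ] H, sliceRight (haarFunctional H a) t =
      sliceRight (haarState H) (((1 : H) ⊗ₜ[ℂ] a) * t) := by
    intro t
    induction t with
    | zero => simp
    | tmul p q => simp [sliceRight]
    | add p q hp hq => simp only [mul_add, map_add, hp, hq]
  have h2 : rightTranslate H (haarFunctional H a) x =
      sliceRight (haarFunctional H a) (comul (R := ℂ) x) := rfl
  rw [h2, h1, strong_invariance_right (ℛ ℂ a)]
  simp [LinearMap.sum_apply]

/-- The right `H`-comodule structure `ω ↦ ω₀ ⊗ ω₁` on the restricted dual which corresponds to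
left multiplication: it is determined by `ω₀(x) ω₁ = x₁ ω(x₂)`, that is, by
`χ ω = χ(ω₁) ω₀` for the convolution product `χ ω = (χ ⊗ ω) Δ`. -/
def restrictedDualCoact : restrictedDual H →ₗ[ℂ] restrictedDual H ⊗[ℂ] H :=
  (LinearEquiv.ofInjective (evalTensor H H) (evalTensor_injective H H)).symm.toLinearMap ∘ₗ
    (rightTranslate H ∘ₗ (restrictedDual H).subtype).codRestrict _ (rightTranslate_mem H)

theorem evalTensor_restrictedDualCoact (ω : restrictedDual H) :
    evalTensor H H (restrictedDualCoact H ω) = rightTranslate H ω := by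
  have := LinearEquiv.apply_symm_apply (LinearEquiv.ofInjective (evalTensor H H)
    (evalTensor_injective H H)) (⟨rightTranslate H ω, rightTranslate_mem H ω⟩)
  exact congrArg Subtype.val this

/-- The comodule structure on the restricted dual corresponds to left multiplication. -/
theorem convMul_eq_restrictedDualCoact (χ : Module.Dual ℂ H) (ω : restrictedDual H) :
    toConv χ * toConv (ω : Module.Dual ℂ H) =
      toConv (TensorProduct.rid ℂ (restrictedDual H)
        (χ.lTensor (restrictedDual H) (restrictedDualCoact H ω)) : Module.Dual ℂ H) := by
  ext x
  have h1 : ∀ t : restrictedDual H ⊗[ℂ] H,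
      (TensorProduct.rid ℂ (restrictedDual H) (χ.lTensor (restrictedDual H) t) :
        Module.Dual ℂ H) x = χ (evalTensor H H t x) := by
    intro t
    induction t with
    | zero => simp
    | tmul p q => simp [mul_comm]
    | add p q hp hq => simp only [map_add, hp, hq, Submodule.coe_add, LinearMap.add_apply]
  rw [(ℛ ℂ x).convMul_apply]
  change _ = (TensorProduct.rid ℂ (restrictedDual H)
    (χ.lTensor (restrictedDual H) (restrictedDualCoact H ω)) : Module.Dual ℂ H) x
  rw [h1, evalTensor_restrictedDualCoact, rightTranslate_apply (ℛ ℂ x)]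
  simp [mul_comm]

variable {H} in
theorem adjointAct_compat (h k : H) :
    comul (R := ℂ) (adjointAct H h k) =
      ydTwist (adjointAct H).toLinearMap h (comul (R := ℂ) k) := by
  let r1 : H →ₗ[ℂ] Module.End ℂ (H ⊗[ℂ] H) :=
    LinearMap.rTensorHom H ∘ₗ (LinearMap.mul ℂ H).flip ∘ₗ antipodeInv H
  let r2 : H →ₗ[ℂ] Module.End ℂ (H ⊗[ℂ] H) :=
    LinearMap.lTensorHom H ∘ₗ (LinearMap.mul ℂ H).flip ∘ₗ antipodeInv H
  let l1 : H →ₗ[ℂ] Module.End ℂ (H ⊗[ℂ] H) := LinearMap.rTensorHom H ∘ₗ LinearMap.mul ℂ H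
  let l2 : H →ₗ[ℂ] Module.End ℂ (H ⊗[ℂ] H) := LinearMap.lTensorHom H ∘ₗ LinearMap.mul ℂ H
  have hA : toConv (LinearMap.rTensorHom H ∘ₗ (adjointAct H).toLinearMap) =
      toConv r1 * toConv l1 := by
    ext a x y
    rw [(ℛ ℂ a).convMul_apply]
    simp [r1, l1, adjointAct_apply (ℛ ℂ a), LinearMap.sum_apply, TensorProduct.sum_tmul]
  have hR : toConv r2 * toConv r1 = toConv ((LinearMap.mul ℂ (H ⊗[ℂ] H)).flip ∘ₗ
      comul (R := ℂ) ∘ₗ antipodeInv H) := by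
    ext a x y
    rw [(ℛ ℂ a).convMul_apply]
    simp [r1, r2, conv_comul_antipodeInv_repr (ℛ ℂ a), LinearMap.sum_apply]
  have hL : toConv l1 * toConv l2 = toConv (LinearMap.mul ℂ (H ⊗[ℂ] H) ∘ₗ comul (R := ℂ)) := by
    ext a x y
    rw [(ℛ ℂ a).convMul_apply]
    simp [l1, l2, ← (ℛ ℂ a).eq, LinearMap.sum_apply]
  have hT : ydTwist (adjointAct H).toLinearMap =
      (toConv ((LinearMap.mul ℂ (H ⊗[ℂ] H)).flip ∘ₗ comul (R := ℂ) ∘ₗ antipodeInv H) *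
        toConv (LinearMap.mul ℂ (H ⊗[ℂ] H) ∘ₗ comul (R := ℂ))).ofConv := by
    rw [ydTwist, hA, ← hR, ← hL]
    simp only [mul_assoc]
    rfl
  rw [hT, (ℛ ℂ h).convMul_apply, adjointAct_apply (ℛ ℂ h)]
  simp [LinearMap.sum_apply, Bialgebra.comul_mul, mul_assoc]

/-- `H` as a Yetter-Drinfeld module, with action `h ▷ k = h₂ k S⁻¹(h₁)` and coaction `Δ`. -/
def adjointYD : YDModule.{u, u} H where
  carrier := H
  act := adjointAct H
  coact := comul
  coassoc v := coassoc_apply v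
  rTensor_counit v := by simp
  compat h v := adjointAct_compat h v

variable {H} in
theorem evalTensor_conv {V W : Type*} [AddCommGroup V] [Module ℂ V] [AddCommGroup W] [Module ℂ W]
    (J : V →ₗ[ℂ] W) (F G : H →ₗ[ℂ] Module.End ℂ V) (F' G' : H →ₗ[ℂ] Module.End ℂ W)
    (hF : ∀ a t, J (F a t) = F' a (J t)) (hG : ∀ a t, J (G a t) = G' a (J t)) (a : H) (t : V) :
    J ((toConv F * toConv G).ofConv a t) = (toConv F' * toConv G').ofConv a (J t) := by
  rw [(ℛ ℂ a).convMul_apply, (ℛ ℂ a).convMul_apply]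
  simp [LinearMap.sum_apply, hF, hG]

variable {H} in
theorem restrictedDualAct_compat (h : H) (ω : restrictedDual H) :
    restrictedDualCoact H (restrictedDualAct H h ω) =
      ydTwist (restrictedDualAct H).toLinearMap h (restrictedDualCoact H ω) := by
  let r : H →ₗ[ℂ] Module.End ℂ (H →ₗ[ℂ] H) :=
    LinearMap.llcomp ℂ H H H ∘ₗ (LinearMap.mul ℂ H).flip ∘ₗ antipodeInv H
  let l : H →ₗ[ℂ] Module.End ℂ (H →ₗ[ℂ] H) := LinearMap.llcomp ℂ H H H ∘ₗ LinearMap.mul ℂ H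
  let p : H →ₗ[ℂ] Module.End ℂ (H →ₗ[ℂ] H) :=
    (LinearMap.llcomp ℂ H H H).flip ∘ₗ (LinearMap.mul ℂ H).flip
  let q : H →ₗ[ℂ] Module.End ℂ (H →ₗ[ℂ] H) :=
    (LinearMap.llcomp ℂ H H H).flip ∘ₗ LinearMap.mul ℂ H ∘ₗ antipodeInv H
  have hr : ∀ a f x, r a f x = f x * antipodeInv H a := fun _ _ _ => rfl
  have hl : ∀ a f x, l a f x = a * f x := fun _ _ _ => rfl
  have hp : ∀ a f x, p a f x = f (x * a) := fun _ _ _ => rfl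
  have hq : ∀ a f x, q a f x = f (antipodeInv H a * x) := fun _ _ _ => rfl
  have hR : ∀ a t, evalTensor H H
      ((LinearMap.lTensorHom _ ∘ₗ (LinearMap.mul ℂ H).flip ∘ₗ antipodeInv H) a t) =
        r a (evalTensor H H t) := by
    intro a t
    ext x
    rw [hr]
    induction t with
    | zero => simp
    | tmul u v => simp
    | add u v hu hv => simp only [map_add, LinearMap.add_apply, hu, hv, add_mul]
  have hL : ∀ a t, evalTensor H H
      ((LinearMap.lTensorHom _ ∘ₗ LinearMap.mul ℂ H) a t) = l a (evalTensor H H t) := by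
    intro a t
    ext x
    rw [hl]
    induction t with
    | zero => simp
    | tmul u v => simp
    | add u v hu hv => simp only [map_add, LinearMap.add_apply, hu, hv, mul_add]
  have hA : ∀ a t, evalTensor H H
      ((LinearMap.rTensorHom H ∘ₗ (restrictedDualAct H).toLinearMap) a t) =
        (toConv p * toConv q).ofConv a (evalTensor H H t) := by
    intro a t
    ext x
    rw [(ℛ ℂ a).convMul_apply]
    simp only [LinearMap.sum_apply, Module.End.mul_apply, hp, hq]
    induction t with
    | zero => simp
    | tmul u v =>
      simp [coe_restrictedDualAct, dualAct_apply (ℛ ℂ a), Finset.sum_smul, mul_assoc]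
    | add u v hu hv => simp only [map_add, LinearMap.add_apply, hu, hv, Finset.sum_add_distrib]
  have hrp : ∀ a (χ : Module.Dual ℂ H), (toConv r * toConv p).ofConv a (rightTranslate H χ) =
      rightTranslate H (dualActRight H a χ) := by
    intro a χ
    ext x
    rw [(ℛ ℂ a).convMul_apply]
    simp only [LinearMap.sum_apply, Module.End.mul_apply, hr, hp]
    have h1 : ∀ t : H ⊗[ℂ] H, sliceRight (dualActRight H a χ) t =
        sliceRight χ (t * ((1 : H) ⊗ₜ[ℂ] a)) := by
      intro t
      induction t with
      | zero => simp
      | tmul u v => simp [sliceRight, dualActRight]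
      | add u v hu hv => simp only [add_mul, map_add, hu, hv]
    change _ = sliceRight (dualActRight H a χ) (comul (R := ℂ) x)
    rw [h1, one_tmul_eq_right (ℛ ℂ a), Finset.mul_sum, map_sum]
    refine Finset.sum_congr rfl fun i _ => ?_
    rw [← mul_assoc, sliceRight_mul', ← Bialgebra.comul_mul]
    rfl
  have hql : ∀ a (χ : Module.Dual ℂ H), (toConv q * toConv l).ofConv a (rightTranslate H χ) =
      rightTranslate H (dualActLeft H a χ) := by
    intro a χ
    ext x
    rw [(ℛ ℂ a).convMul_apply]
    simp only [LinearMap.sum_apply, Module.End.mul_apply, hl, hq]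
    have h1 : ∀ t : H ⊗[ℂ] H, sliceRight (dualActLeft H a χ) t =
        sliceRight χ (((1 : H) ⊗ₜ[ℂ] antipodeInv H a) * t) := by
      intro t
      induction t with
      | zero => simp
      | tmul u v => simp [sliceRight, dualActLeft]
      | add u v hu hv => simp only [mul_add, map_add, hu, hv]
    have h2 : toConv (opL _ ∘ₗ comul (R := ℂ) (A := H) ∘ₗ antipodeInv H) *
        toConv (opL _ ∘ₗ (inlT (H := H)).toLinearMap) =
        toConv (opL _ ∘ₗ (inrT (H := H)).toLinearMap ∘ₗ antipodeInv H) := by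
      rw [← conv_op_comul_antipodeInv, mul_assoc, conv_op_antipodeInv_left, mul_one]
    replace h2 := congrArg (fun f => MulOpposite.unop (f a)) h2
    simp only [(ℛ ℂ a).convMul_apply] at h2
    have h3 : ∑ i ∈ (ℛ ℂ a).index, ((ℛ ℂ a).right i ⊗ₜ[ℂ] (1 : H)) *
        comul (R := ℂ) (antipodeInv H ((ℛ ℂ a).left i)) = (1 : H) ⊗ₜ[ℂ] antipodeInv H a := by
      simpa [← MulOpposite.op_mul] using h2
    change _ = sliceRight (dualActLeft H a χ) (comul (R := ℂ) x)
    rw [h1, ← h3, Finset.sum_mul, map_sum]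
    refine Finset.sum_congr rfl fun i _ => ?_
    rw [mul_assoc, sliceRight_mul, ← Bialgebra.comul_mul]
    rfl
  apply evalTensor_injective H H
  have h0 := evalTensor_conv (V := restrictedDual H ⊗[ℂ] H)
    (W := H →ₗ[ℂ] H) (evalTensor H H)
    (LinearMap.lTensorHom _ ∘ₗ (LinearMap.mul ℂ H).flip ∘ₗ antipodeInv H)
    (LinearMap.rTensorHom H ∘ₗ (restrictedDualAct H).toLinearMap) r (toConv p * toConv q).ofConv
    hR hA
  have h1 := evalTensor_conv (V := restrictedDual H ⊗[ℂ] H)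
    (W := H →ₗ[ℂ] H) (evalTensor H H) _ (LinearMap.lTensorHom _ ∘ₗ LinearMap.mul ℂ H)
    _ l h0 hL h (restrictedDualCoact H ω)
  simp only [toConv_ofConv] at h1
  rw [ydTwist, h1, evalTensor_restrictedDualCoact, evalTensor_restrictedDualCoact,
    ← mul_assoc (toConv r), mul_assoc, (ℛ ℂ h).convMul_apply, coe_restrictedDualAct]
  simp only [LinearMap.sum_apply, Module.End.mul_apply]
  simp only [hql, hrp]
  rw [← map_sum, dualAct, sum_algLift_apply _ _ _ (ℛ ℂ h)]

theorem restrictedDualCoact_coassoc (ω : restrictedDual H) :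
    TensorProduct.assoc ℂ (restrictedDual H) H H
        ((restrictedDualCoact H).rTensor H (restrictedDualCoact H ω)) =
      (comul (R := ℂ) (A := H)).lTensor (restrictedDual H) (restrictedDualCoact H ω) := by
  apply evalTensor_injective H (H ⊗[ℂ] H)
  ext x
  have h1 : ∀ t : restrictedDual H ⊗[ℂ] H, evalTensor H (H ⊗[ℂ] H)
      ((comul (R := ℂ) (A := H)).lTensor (restrictedDual H) t) x =
        comul (R := ℂ) (evalTensor H H t x) := by
    intro t
    induction t with
    | zero => simp
    | tmul u v => simp
    | add u v hu hv => simp only [map_add, LinearMap.add_apply, hu, hv]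
  have h2 : ∀ (t : restrictedDual H ⊗[ℂ] H) (k : H), evalTensor H (H ⊗[ℂ] H)
      (TensorProduct.assoc ℂ (restrictedDual H) H H (t ⊗ₜ[ℂ] k)) x =
        evalTensor H H t x ⊗ₜ[ℂ] k := by
    intro t k
    induction t with
    | zero => simp
    | tmul u v => simp [TensorProduct.smul_tmul']
    | add u v hu hv => simp only [map_add, LinearMap.add_apply, TensorProduct.add_tmul, hu, hv]
  have h3 : ∀ t : restrictedDual H ⊗[ℂ] H, evalTensor H (H ⊗[ℂ] H)
      (TensorProduct.assoc ℂ (restrictedDual H) H H ((restrictedDualCoact H).rTensor H t)) x =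
        (evalTensor H H t).lTensor H (comul (R := ℂ) x) := by
    intro t
    induction t with
    | zero => simp
    | tmul u v =>
      rw [LinearMap.rTensor_tmul, h2, evalTensor_restrictedDualCoact,
        rightTranslate_apply (ℛ ℂ x), ← (ℛ ℂ x).eq]
      simp [TensorProduct.sum_tmul, TensorProduct.smul_tmul]
    | add u v hu hv =>
      simp only [map_add, LinearMap.add_apply, LinearMap.lTensor_add, hu, hv]
  have h4 : ∀ t : (H ⊗[ℂ] H) ⊗[ℂ] H, (sliceRight (ω : Module.Dual ℂ H)).lTensor H
      (TensorProduct.assoc ℂ H H H t) =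
        TensorProduct.rid ℂ (H ⊗[ℂ] H) ((ω : Module.Dual ℂ H).lTensor (H ⊗[ℂ] H) t) := by
    intro t
    induction t with
    | zero => simp
    | add u v hu hv => simp only [map_add, hu, hv]
    | tmul u v =>
      induction u with
      | zero => simp
      | add a b ha hb => simp only [TensorProduct.add_tmul, map_add, ha, hb]
      | tmul a b => simp [sliceRight]
  have h5 : ∀ t : H ⊗[ℂ] H, TensorProduct.rid ℂ (H ⊗[ℂ] H)
      ((ω : Module.Dual ℂ H).lTensor (H ⊗[ℂ] H) ((comul (R := ℂ) (A := H)).rTensor H t)) =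
        comul (R := ℂ) (sliceRight (ω : Module.Dual ℂ H) t) := by
    intro t
    induction t with
    | zero => simp
    | add u v hu hv => simp only [map_add, hu, hv]
    | tmul u v => simp [sliceRight]
  rw [h1, h3, evalTensor_restrictedDualCoact]
  change (sliceRight (ω : Module.Dual ℂ H) ∘ₗ comul (R := ℂ)).lTensor H (comul (R := ℂ) x) =
    comul (R := ℂ) (sliceRight (ω : Module.Dual ℂ H) (comul (R := ℂ) x))
  rw [LinearMap.lTensor_comp_apply, ← coassoc_apply, h4, h5]

theorem restrictedDualCoact_counit (ω : restrictedDual H) :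
    TensorProduct.rid ℂ (restrictedDual H)
      ((counit (R := ℂ) (A := H)).lTensor (restrictedDual H) (restrictedDualCoact H ω)) = ω := by
  have h := convMul_eq_restrictedDualCoact H (counit (R := ℂ) (A := H)) ω
  have h1 : toConv (counit (R := ℂ) (A := H)) = 1 := rfl
  rw [h1, one_mul] at h
  exact (Subtype.ext (toConv_injective h)).symm

/-- The restricted dual of `H` as a Yetter-Drinfeld module, with action
`h ▶ ω = ω(S⁻¹(h₂) - h₁)` and the coaction corresponding to left multiplication. -/
def restrictedDualYD : YDModule.{u, u} H where
  carrier := restrictedDual H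
  act := restrictedDualAct H
  coact := restrictedDualCoact H
  coassoc := restrictedDualCoact_coassoc H
  rTensor_counit := restrictedDualCoact_counit H
  compat := restrictedDualAct_compat

/-- `H` is of Kac type if its Haar state is tracial. -/
def IsKacType : Prop := ∀ a b : H, haarState H (a * b) = haarState H (b * a)

end YetterDrinfeld

end CQG

end

namespace CQG

open Coalgebra HopfAlgebra WithConv

universe u

set_option linter.unusedSectionVars false

variable {H : Type u} [Ring H] [StarRing H] [HopfAlgebra ℂ H] [StarModule ℂ H]
  [CQGHopfStarAlgebra H]

/-! If `Φ` is a trace, the isomorphism is the Fourier-type map `k ↦ Φ(S⁻¹(k) -)`. It is colinear for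
every CQG algebra, by strong invariance (`haarTransform_coact`). Moving the action of `h` through it
produces a factor `S⁻²(h₁)` on the left of the argument of `Φ`, where the dual action wants `h₁` on
the right: the trace property moves the factor, and it also forces `S² = id`
(`IsKacType.antipodeInv_eq_antipode`), which removes `S⁻²`.

Conversely, `1 ∈ H` is coinvariant and satisfies `h ▷ 1 = ε(h) 1`. An isomorphism sends it to a
nonzero coinvariant functional, which must be a multiple of `Φ` (`eq_smul_haarState`), so `Φ` is
itself invariant under `▶`. Untwisting this invariance gives `Φ(a x) = Φ(x S²(a))`
(`haarState_mul_eq`). Two strong invariance formulas then yield `S⁻¹ = S³`, that is `S⁴ = id`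
(`antipode_pow_four`). Positivity excludes the eigenvalue `-1` of `S²`: if `S²(b) = -b`, then `Φ(b
b*) = -Φ(b* b)`, so both vanish and `b = 0` by `eq_zero_of_haarState_star_mul_self`. Hence `S² =
id`, and the modular relation becomes the trace property. -/

theorem antipodeInv_injective : Function.Injective (antipodeInv H) :=
  Function.LeftInverse.injective antipode_antipodeInv

/-! ### Strong invariance of the Haar state in the first tensor leg. -/

theorem sliceLeft_mul' (Φ : H →ₗ[ℂ] ℂ) (b : H) (t : H ⊗[ℂ] H) :
    sliceLeft Φ (t * ((1 : H) ⊗ₜ[ℂ] b)) = sliceLeft Φ t * b := by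
  induction t with
  | zero => simp
  | tmul x y => simp [sliceLeft]
  | add x y hx hy => simp only [add_mul, map_add, hx, hy]

/-- `a ⊗ 1 = Δ(a₁) (1 ⊗ S(a₂))`. -/
theorem tmul_one_eq_right {ι : Type*} {a : H} (𝓡 : Coalgebra.Repr ℂ a ι) :
    (a ⊗ₜ[ℂ] (1 : H)) = ∑ i ∈ 𝓡.index,
      comul (R := ℂ) (𝓡.left i) * ((1 : H) ⊗ₜ[ℂ] antipode ℂ (𝓡.right i)) := by
  -- In the convolution algebra of linear maps `H → H ⊗ H`, `Δ` is the product of `a ↦ a ⊗ 1` and `b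
  -- ↦ 1 ⊗ b`; the second factor is cancelled by its right inverse `b ↦ 1 ⊗ S(b)`.
  have h0 : toConv (inrT (H := H)).toLinearMap *
      toConv ((inrT (H := H)).toLinearMap ∘ₗ antipode ℂ (A := H)) = 1 := by
    ext a
    rw [(ℛ ℂ a).convMul_apply]
    have h := congrArg (inrT (H := H)) (sum_mul_antipode_eq_smul (R := ℂ) (ℛ ℂ a))
    simpa [Algebra.algebraMap_eq_smul_one, Algebra.TensorProduct.one_def] using h
  have h : toConv (inlT (H := H)).toLinearMap =
      toConv (comul (R := ℂ) (A := H)) *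
        toConv ((inrT (H := H)).toLinearMap ∘ₗ antipode ℂ (A := H)) := by
    rw [← conv_inl_inr, mul_assoc, h0, mul_one]
  replace h := congrArg (fun f => f a) h
  simp only [𝓡.convMul_apply] at h
  simpa using h

/-- `Φ(x₁ a) x₂ = S(a₂) Φ(x a₁)`. -/
theorem strong_invariance_left' {ι : Type*} {a : H} (𝓡 : Coalgebra.Repr ℂ a ι) (x : H) :
    sliceLeft (haarState H) (comul (R := ℂ) x * (a ⊗ₜ[ℂ] (1 : H))) =
      ∑ i ∈ 𝓡.index, haarState H (x * 𝓡.left i) • antipode ℂ (𝓡.right i) := by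
  rw [tmul_one_eq_right 𝓡, Finset.mul_sum, map_sum]
  refine Finset.sum_congr rfl fun i _ => ?_
  rw [← mul_assoc, ← Bialgebra.comul_mul, sliceLeft_mul',
    (haarState_isInvariantState H).sliceLeft_comul]
  simp

/-! ### The Haar state of Kac type -/

/-- In Kac type the antipode is involutive. -/
theorem IsKacType.antipodeInv_eq_antipode (hK : IsKacType H) (a : H) :
    antipodeInv H a = antipode ℂ a := by
  classical
  let 𝓡 := ℛ ℂ a
  -- The functional `Φ(e -)` agrees with `ε` on the finitely many second legs of `Δ(a)`. Traciality
  -- identifies the left sides of the two strong invariance formulas; at `x = e` their right sides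
  -- collapse to `S(a)` and `S⁻¹(a)`.
  obtain ⟨e, he⟩ := exists_local_counit (𝓡.index.image 𝓡.right)
  have h1 := strong_invariance_right 𝓡 e
  have h2 := strong_invariance_right' 𝓡 e
  have h3 : ∀ t : H ⊗[ℂ] H, sliceRight (haarState H) (((1 : H) ⊗ₜ[ℂ] a) * t) =
      sliceRight (haarState H) (t * ((1 : H) ⊗ₜ[ℂ] a)) := by
    intro t
    induction t with
    | zero => simp
    | tmul p q => simp [sliceRight, hK a q]
    | add p q hp hq => simp only [mul_add, add_mul, map_add, hp, hq]
  have h4 : ∑ i ∈ 𝓡.index, counit (R := ℂ) (𝓡.right i) • 𝓡.left i = a := by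
    have h := congrArg (TensorProduct.rid ℂ H) (sum_tmul_counit_eq (R := ℂ) 𝓡)
    simpa only [map_sum, TensorProduct.rid_tmul, one_smul] using h
  rw [h3, h2] at h1
  have h5 : ∀ f : H →ₗ[ℂ] H,
      ∑ i ∈ 𝓡.index, haarState H (e * 𝓡.right i) • f (𝓡.left i) = f a := by
    intro f
    conv_rhs => rw [← h4, map_sum]
    refine Finset.sum_congr rfl fun i hi => ?_
    rw [he _ (Finset.mem_image_of_mem _ hi), map_smul]
  rw [← h5 (antipodeInv H), ← h5 (antipode ℂ), h1]
  exact Finset.sum_congr rfl fun i _ => by rw [hK]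

/-! ### The Fourier-type transform as a Yetter-Drinfeld isomorphism. -/

/-- The map `k ↦ Φ(S⁻¹(k) -)` from `H` to the restricted dual. -/
noncomputable def haarTransform (H : Type u) [Ring H] [StarRing H] [HopfAlgebra ℂ H]
    [StarModule ℂ H] [CQGHopfStarAlgebra H] : H →ₗ[ℂ] restrictedDual H :=
  (haarFunctional H).rangeRestrict ∘ₗ antipodeInv H

theorem haarTransform_apply (k x : H) :
    (haarTransform H k : Module.Dual ℂ H) x = haarState H (antipodeInv H k * x) := rfl

/-- The functional `Φ(S⁻¹(k) -)` depends colinearly on `k`. -/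
theorem haarTransform_coact (k : H) :
    restrictedDualCoact H (haarTransform H k) =
      (haarTransform H).rTensor H (comul (R := ℂ) k) := by
  apply evalTensor_injective H H
  ext x
  rw [evalTensor_restrictedDualCoact]
  -- Since `S⁻¹` flips the legs, strong invariance gives `Φ(S⁻¹(k₁) x) S(S⁻¹(k₂))`, where the
  -- antipodes cancel.
  let 𝓡 : Coalgebra.Repr ℂ (antipodeInv H k) _ :=
    { index := (ℛ ℂ k).index
      left := fun i => antipodeInv H ((ℛ ℂ k).right i)
      right := fun i => antipodeInv H ((ℛ ℂ k).left i)
      eq := (conv_comul_antipodeInv_repr (ℛ ℂ k)).symm }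
  have h1 : ∀ t : H ⊗[ℂ] H, sliceRight (haarTransform H k : Module.Dual ℂ H) t =
      sliceRight (haarState H) (((1 : H) ⊗ₜ[ℂ] antipodeInv H k) * t) := by
    intro t
    induction t with
    | zero => simp
    | tmul p q => simp [sliceRight, haarTransform_apply]
    | add p q hp hq => simp only [mul_add, map_add, hp, hq]
  change sliceRight (haarTransform H k : Module.Dual ℂ H) (comul (R := ℂ) x) = _
  rw [h1, strong_invariance_right 𝓡, ← (ℛ ℂ k).eq]
  simp [𝓡, LinearMap.sum_apply, haarTransform_apply, antipode_antipodeInv]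

/-- Expanding gives `Φ(S⁻²(h₁) S⁻¹(k) S⁻¹(h₂) x)`. Here `S⁻² = id`, and traciality carries `h₁` to
the far right. This is the only part of the morphism property that needs Kac type. -/
theorem IsKacType.haarTransform_act (hK : IsKacType H) (h k : H) :
    haarTransform H (adjointAct H h k) = restrictedDualAct H h (haarTransform H k) := by
  ext x
  rw [coe_restrictedDualAct, dualAct_apply (ℛ ℂ h), haarTransform_apply,
    adjointAct_apply (ℛ ℂ h), map_sum, Finset.sum_mul, map_sum]
  refine Finset.sum_congr rfl fun i _ => ?_
  rw [haarTransform_apply, antipodeInv_mul, antipodeInv_mul,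
    hK.antipodeInv_eq_antipode (antipodeInv H _), antipode_antipodeInv,
    mul_assoc ((ℛ ℂ h).left i), hK]
  simp only [mul_assoc]

theorem IsKacType.haarTransform_bijective (hK : IsKacType H) :
    Function.Bijective (haarTransform H) := by
  constructor
  · rw [injective_iff_map_eq_zero]
    intro k hk
    refine antipodeInv_injective ?_
    rw [map_zero]
    refine haarState_faithful fun x => ?_
    -- `haarState_faithful` tests against left multiples, while the transform pairs from the other
    -- side; the trace property exchanges them.
    rw [hK, ← haarTransform_apply, hk]
    rfl
  · rintro ⟨_, a, rfl⟩
    refine ⟨antipode ℂ a, Subtype.ext ?_⟩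
    ext x
    rw [haarTransform_apply, antipodeInv_antipode]
    rfl

/-- A bijective morphism of Yetter-Drinfeld modules is an isomorphism. -/
noncomputable def YDModule.Hom.isoOfBijective {M N : YDModule.{u, u} H} (f : M ⟶ N)
    (hf : Function.Bijective f.toLinearMap) : M ≅ N where
  hom := f
  inv :=
    { toLinearMap := (LinearEquiv.ofBijective f.toLinearMap hf).symm.toLinearMap
      map_act := fun h v => by
        obtain ⟨w, rfl⟩ := hf.2 v
        rw [← f.map_act]
        change (LinearEquiv.ofBijective f.toLinearMap hf).symm
          (LinearEquiv.ofBijective f.toLinearMap hf _) = M.act h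
            ((LinearEquiv.ofBijective f.toLinearMap hf).symm
              (LinearEquiv.ofBijective f.toLinearMap hf w))
        simp only [LinearEquiv.symm_apply_apply]
      map_coact := fun v => by
        obtain ⟨w, rfl⟩ := hf.2 v
        rw [f.map_coact, ← LinearMap.rTensor_comp_apply]
        have h1 : (LinearEquiv.ofBijective f.toLinearMap hf).symm.toLinearMap ∘ₗ f.toLinearMap =
            LinearMap.id :=
          LinearMap.ext fun x => (LinearEquiv.ofBijective f.toLinearMap hf).symm_apply_apply x
        have h2 := LinearMap.congr_fun h1 w
        rw [LinearMap.comp_apply] at h2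
        rw [h1, h2]
        simp }
  hom_inv_id := YDModule.Hom.ext <|
    LinearMap.ext fun x => (LinearEquiv.ofBijective f.toLinearMap hf).symm_apply_apply x
  inv_hom_id := YDModule.Hom.ext <|
    LinearMap.ext fun x => (LinearEquiv.ofBijective f.toLinearMap hf).apply_symm_apply x

theorem IsKacType.nonempty_iso (hK : IsKacType H) :
    Nonempty (adjointYD H ≅ restrictedDualYD H) :=
  let f : adjointYD H ⟶ restrictedDualYD H :=
    { toLinearMap := haarTransform H
      map_act := hK.haarTransform_act
      map_coact := fun k => haarTransform_coact (H := H) k }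
  ⟨YDModule.Hom.isoOfBijective f hK.haarTransform_bijective⟩

/-! ### From an isomorphism to the trace property -/

/-- A functional with `x₁ ω(x₂) = ω(x) 1` is a multiple of the Haar state. -/
theorem eq_smul_haarState {ω : Module.Dual ℂ H} (hω : ∀ x, rightTranslate H ω x = ω x • (1 : H)) :
    ω = ω 1 • haarState H := by
  ext x
  -- Both sides are `(Φ ⊗ ω)(t)`. At `t = Δ(x)` the first is `ω(x)` by coinvariance, the second
  -- `Φ(x) ω(1)` by invariance of `Φ`.
  have h1 : ∀ t : H ⊗[ℂ] H, haarState H (sliceRight ω t) = ω (sliceLeft (haarState H) t) := by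
    intro t
    induction t with
    | zero => simp
    | tmul p q => simp [sliceLeft, sliceRight, mul_comm]
    | add p q hp hq => simp [hp, hq]
  have h2 := congrArg (haarState H) (hω x)
  change haarState H (sliceRight ω (comul (R := ℂ) x)) = _ at h2
  rw [h1, (haarState_isInvariantState H).sliceLeft_comul] at h2
  simpa [(haarState_isInvariantState H).map_one, mul_comm] using h2.symm

/-- If `Φ` is invariant under the action on functionals, then `Φ(S⁻¹(b) x) = Φ(x S(b))`. -/
theorem haarState_antipodeInv_mul
    (hΦ : ∀ h : H, dualAct H h (haarState H) = counit (R := ℂ) h • haarState H) (b x : H) :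
    haarState H (antipodeInv H b * x) = haarState H (x * antipode ℂ b) := by
  -- Write `R` and `L` for the actions `ω(- a)` and `ω(S⁻¹(a) -)`. As convolution products, `▶` is
  -- `R * L`, and `R ∘ S` is a left inverse of `R`, so `L = (R ∘ S) * ▶`. On `Φ` the last factor
  -- contributes only `ε`, leaving `Φ(- S(b))`.
  have h0 : toConv ((dualActRight H).toLinearMap ∘ₗ antipode ℂ (A := H)) *
      toConv (dualActRight H).toLinearMap = 1 := by
    refine WithConv.ext (LinearMap.ext fun a => ?_)
    rw [(ℛ ℂ a).convMul_apply]
    have h := congrArg (dualActRight H) (sum_antipode_mul_eq_smul (R := ℂ) (ℛ ℂ a))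
    simpa [Algebra.algebraMap_eq_smul_one] using h
  have h1 : toConv (dualAct H).toLinearMap =
      toConv (dualActRight H).toLinearMap * toConv (dualActLeft H).toLinearMap := by
    refine WithConv.ext (LinearMap.ext fun a => ?_)
    rw [(ℛ ℂ a).convMul_apply]
    refine LinearMap.ext fun ω => ?_
    have h := sum_algLift_apply (dualActRight H) (dualActLeft H) (commute_dualAct H) (ℛ ℂ a) ω
    rw [LinearMap.sum_apply]
    exact h
  have h2 : toConv (dualActLeft H).toLinearMap =
      toConv ((dualActRight H).toLinearMap ∘ₗ antipode ℂ (A := H)) *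
        toConv (dualAct H).toLinearMap := by
    rw [h1, ← mul_assoc, h0, one_mul]
  have h3 := congrArg (fun f => f b (haarState H) x) h2
  simp only [(ℛ ℂ b).convMul_apply, LinearMap.sum_apply] at h3
  have h4 : ∑ i ∈ (ℛ ℂ b).index, counit (R := ℂ) ((ℛ ℂ b).right i) • (ℛ ℂ b).left i = b := by
    have h := congrArg (TensorProduct.rid ℂ H) (sum_tmul_counit_eq (R := ℂ) (ℛ ℂ b))
    simpa only [map_sum, TensorProduct.rid_tmul, one_smul] using h
  conv_rhs => rw [← h4, map_sum, Finset.mul_sum, map_sum]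
  refine Eq.trans h3 (Finset.sum_congr rfl fun i _ => ?_)
  simp [hΦ, dualActRight]

theorem haarState_mul_eq
    (hΦ : ∀ h : H, dualAct H h (haarState H) = counit (R := ℂ) h • haarState H) (a x : H) :
    haarState H (a * x) = haarState H (x * antipode ℂ (antipode ℂ a)) := by
  rw [← haarState_antipodeInv_mul hΦ, antipodeInv_antipode]

/-! ### The modular relation forces the antipode to have order dividing four. -/

/-- The antipode reverses the comultiplication. -/
theorem comul_antipode (a : H) :
    comul (R := ℂ) (antipode ℂ a) = TensorProduct.comm ℂ H H
      (TensorProduct.map (antipode ℂ) (antipode ℂ) (comul (R := ℂ) a)) := by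
  -- The formula for `Δ ∘ S⁻¹` is applied at `S(a)`, so that it expresses `Δ(a)` through `Δ(S(a))`.
  have h := conv_comul_antipodeInv_repr (ℛ ℂ (antipode ℂ a))
  rw [antipodeInv_antipode] at h
  rw [h]
  simp [antipode_antipodeInv, (ℛ ℂ (antipode ℂ a)).eq]

/-- The square of the antipode preserves the comultiplication. -/
theorem sum_antipode_antipode_tmul {ι : Type*} {a : H} (𝓡 : Coalgebra.Repr ℂ a ι) :
    ∑ i ∈ 𝓡.index, antipode ℂ (antipode ℂ (𝓡.left i)) ⊗ₜ[ℂ] antipode ℂ (antipode ℂ (𝓡.right i)) =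
      comul (R := ℂ) (antipode ℂ (antipode ℂ a)) := by
  rw [comul_antipode, comul_antipode, ← 𝓡.eq]
  simp

/-- If `S²` is the modular automorphism of `Φ`, then `S⁴ = id`. -/
theorem antipode_pow_four
    (hσ : ∀ a x : H, haarState H (a * x) = haarState H (x * antipode ℂ (antipode ℂ a))) (a : H) :
    antipode ℂ (antipode ℂ (antipode ℂ (antipode ℂ a))) = a := by
  classical
  let 𝓡 := ℛ ℂ a
  let 𝓢 : Coalgebra.Repr ℂ (antipode ℂ (antipode ℂ a)) _ :=
    { index := 𝓡.index
      left := fun i => antipode ℂ (antipode ℂ (𝓡.left i))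
      right := fun i => antipode ℂ (antipode ℂ (𝓡.right i))
      eq := sum_antipode_antipode_tmul 𝓡 }
  -- Here `Φ(e S²(a₁)) = ε(a₁)`, which also equals `Φ(a₁ e)` by `hσ`. At `x = e` the formulas for
  -- `a` and `S²(a)` thus collapse to `S⁻¹(a)` and `S³(a)`.
  obtain ⟨e, he⟩ := exists_local_counit (𝓢.index.image 𝓢.left)
  have h1 := strong_invariance_left 𝓡 e
  have h2 := strong_invariance_left' 𝓢 e
  have h3 : ∀ t : H ⊗[ℂ] H, sliceLeft (haarState H) ((a ⊗ₜ[ℂ] (1 : H)) * t) =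
      sliceLeft (haarState H) (t * (antipode ℂ (antipode ℂ a) ⊗ₜ[ℂ] (1 : H))) := by
    intro t
    induction t with
    | zero => simp
    | tmul p q => simp [sliceLeft, hσ a p]
    | add p q hp hq => simp only [mul_add, add_mul, map_add, hp, hq]
  have h4 : ∑ i ∈ 𝓡.index, counit (R := ℂ) (𝓡.left i) • 𝓡.right i = a := sum_counit_smul 𝓡
  rw [h3, h2] at h1
  have h5 : ∀ f : H →ₗ[ℂ] H,
      ∑ i ∈ 𝓡.index, haarState H (e * antipode ℂ (antipode ℂ (𝓡.left i))) • f (𝓡.right i) =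
        f a := by
    intro f
    conv_rhs => rw [← h4, map_sum]
    refine Finset.sum_congr rfl fun i hi => ?_
    rw [he _ (Finset.mem_image_of_mem 𝓢.left hi), map_smul]
    simp [𝓢]
  refine antipodeInv_injective ?_
  rw [antipodeInv_antipode]
  have h6 := h5 (antipode ℂ ∘ₗ antipode ℂ ∘ₗ antipode ℂ)
  rw [← h5 (antipodeInv H)]
  refine Eq.trans h6.symm (Eq.trans h1 (Finset.sum_congr rfl fun i _ => ?_))
  rw [hσ]

/-! ### Positivity of the Haar state and the trace property. -/

/-- A vector of norm zero for the Haar state vanishes. -/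
theorem eq_zero_of_haarState_star_mul_self {a : H} (ha : haarState H (star a * a) = 0) :
    a = 0 := by
  refine haarState_faithful fun y => ?_
  obtain ⟨x, rfl⟩ : ∃ x, star x = y := ⟨star y, star_star y⟩
  -- This is `Φ((a + t x)* (a + t x)) ≥ 0` with the vanishing term `Φ(a* a)` dropped, as in the
  -- proof of Cauchy-Schwarz.
  have hexp : ∀ t : ℂ, 0 ≤ t * haarState H (star a * x) +
      star t * haarState H (star x * a) + star t * t * haarState H (star x * x) := by
    intro t
    have h := (haarState_isInvariantState H).nonneg (a + t • x)
    simp only [star_add, star_smul, add_mul, mul_add, map_add, smul_mul_assoc, mul_smul_comm,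
      map_smul, smul_eq_mul, ha] at h
    refine h.trans_eq ?_
    ring
  have hN := (haarState_isInvariantState H).nonneg x
  set p := haarState H (star a * x)
  set q := haarState H (star x * a)
  set N := haarState H (star x * x)
  obtain ⟨hN0, hN1⟩ := Complex.nonneg_iff.1 hN
  -- Nonnegativity in `ℂ` includes being real; the imaginary parts at `t = i` and `t = 1` show that
  -- `p` is the conjugate of `q`, so hermiticity of `Φ` need not be assumed.
  have hre : p.re = q.re := by
    have h := (Complex.nonneg_iff.1 (hexp Complex.I)).2
    simp [← hN1] at h
    linarith
  have him : p.im = -q.im := by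
    have h := (Complex.nonneg_iff.1 (hexp 1)).2
    simp [← hN1] at h
    linarith
  have hε : 0 < (N.re + 1)⁻¹ := by positivity
  have hεN : (N.re + 1)⁻¹ * N.re ≤ 1 := by
    rw [inv_mul_le_iff₀ (by positivity)]
    linarith
  generalize (N.re + 1)⁻¹ = ε at hε hεN
  -- At `t = -ε q` the expression equals `ε |q|² (ε N - 2)`. Since `ε N ≤ 1`, the last factor is
  -- negative, which forces `q = 0`.
  have h := (Complex.nonneg_iff.1 (hexp (-((ε : ℂ) * q)))).1
  simp [← hN1, hre, him] at h
  have hq : 0 ≤ q.re ^ 2 + q.im ^ 2 := by positivity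
  have h1 : 0 ≤ ε * ((q.re ^ 2 + q.im ^ 2) * (ε * N.re - 2)) := by linarith
  have h2 := nonneg_of_mul_nonneg_right h1 hε
  have h3 : q.re ^ 2 + q.im ^ 2 = 0 := by nlinarith
  refine Complex.ext ?_ ?_ <;> simp <;> nlinarith [sq_nonneg q.re, sq_nonneg q.im]

/-- If `S²` is the modular automorphism of `Φ`, then `Φ` is tracial. -/
theorem isKacType_of_haarState_mul_eq
    (hσ : ∀ a x : H, haarState H (a * x) = haarState H (x * antipode ℂ (antipode ℂ a))) :
    IsKacType H := by
  have h1 : ∀ a : H, antipode ℂ (antipode ℂ a) = a := by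
    intro a
    -- Up to a scalar, `b` is the component of `a` in the `-1` eigenspace of the involution `S²`.
    let b := antipode ℂ (antipode ℂ a) - a
    have hb : antipode ℂ (antipode ℂ b) = -b := by
      simp only [b, map_sub, antipode_pow_four hσ]
      abel
    have h2 : haarState H (b * star b) = -haarState H (star b * b) := by
      rw [hσ, hb, mul_neg, map_neg]
    have h3 := (haarState_isInvariantState H).nonneg b
    have h4 := (haarState_isInvariantState H).nonneg (star b)
    rw [star_star, h2] at h4
    exact sub_eq_zero.1 (eq_zero_of_haarState_star_mul_self
      (le_antisymm (neg_nonneg.1 h4) h3))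
  intro a b
  rw [hσ, h1]

/-- Only the image of `1` under the isomorphism is used: it is a nonzero multiple of `Φ`, and it
inherits coinvariance and the trivial action from `1`. -/
theorem isKacType_of_iso (e : adjointYD H ≅ restrictedDualYD H) : IsKacType H := by
  let J : H →ₗ[ℂ] restrictedDual H := e.hom.toLinearMap
  have hJ : ∀ k, e.inv.toLinearMap (J k) = k := fun k =>
    LinearMap.congr_fun (congrArg YDModule.Hom.toLinearMap e.hom_inv_id) k
  let ω : Module.Dual ℂ H := J 1
  have hω : ω = ω 1 • haarState H := by
    refine eq_smul_haarState fun x => ?_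
    have h1 : restrictedDualCoact H (J 1) = J.rTensor H (comul (R := ℂ) 1) :=
      e.hom.map_coact (1 : H)
    have h2 := evalTensor_restrictedDualCoact H (J 1)
    rw [h1] at h2
    have h3 := LinearMap.congr_fun h2 x
    rw [Bialgebra.comul_one, Algebra.TensorProduct.one_def, LinearMap.rTensor_tmul,
      evalTensor_tmul] at h3
    exact h3.symm
  -- Otherwise `J 1 = 0`, and injectivity of `J` gives `1 = 0` in `H`, against `Φ(1) = 1`.
  have hω1 : ω 1 ≠ 0 := by
    intro h0
    rw [h0, zero_smul] at hω
    have h1 : J 1 = 0 := Subtype.ext hω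
    have h2 := hJ 1
    rw [h1] at h2
    have h3 : (1 : H) = 0 := h2.symm.trans (map_zero e.inv.toLinearMap)
    have h4 := (haarState_isInvariantState H).map_one
    rw [h3, map_zero] at h4
    exact zero_ne_one h4
  refine isKacType_of_haarState_mul_eq (haarState_mul_eq fun h => ?_)
  have h1 : J (adjointAct H h 1) = restrictedDualAct H h (J 1) := e.hom.map_act h (1 : H)
  have h2 : adjointAct H h 1 = counit (R := ℂ) h • (1 : H) := by
    rw [adjointAct_apply (ℛ ℂ h), ← sum_mul_antipodeInv (ℛ ℂ h)]
    simp
  rw [h2, map_smul] at h1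
  have h3 : counit (R := ℂ) h • ω = dualAct H h ω := congrArg Subtype.val h1
  rw [hω, map_smul, smul_comm] at h3
  exact (smul_right_injective _ hω1 h3).symm

end CQG

theorem proposition2p3 {H : Type*} [Ring H] [StarRing H] [HopfAlgebra ℂ H] [StarModule ℂ H]
    [CQG.CQGHopfStarAlgebra H] :
    Nonempty (CQG.adjointYD H ≅ CQG.restrictedDualYD H) ↔ CQG.IsKacType H :=
  ⟨fun ⟨e⟩ => CQG.isKacType_of_iso e, fun hK => hK.nonempty_iso⟩
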